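/- Let $p\ge 1$ be a real number and let $E$ be a $\sigma$-Dedekind complete (real) Banach lattice, that is, a Banach lattice in which every nonempty countable set that is bounded above has a supremum. Let $E^*$ be its dual Banach lattice. A sequence in a Banach lattice is disjoint if $|x_m|\wedge|x_n|=0$ for all $m\neq n$; a sequence $(x_n)_n$ in $E$ is weakly $p$-summable if $\sum_n |x^*(x_n)|^p<\infty$ for every $x^*\in E^*$. A set $A\subseteq E$ is limited if every weak* null sequence in $E^*$ converges to zero uniformly on $A$; a bounded set $A\subseteq E$ is almost limited if every disjoint weak* null sequence in $E^*$ converges to zero uniformly on $A$. A sequence is called limited (almost limited) if its set of terms is. Then the following are equivalent: (a) $E$ has the disjoint Dunford-Pettis* property of order $p$ (disjoint $DP^*P_p$), that is, every disjoint weakly $p$-summable sequence in $E$ is limited. (b) Every disjoint weakly $p$-summable sequence in $E$ is almost limited. (c) For every disjoint weakly $p$-summable sequence $(x_n)_n$ in $E$ and every disjoint weak* null sequence $(x_n^*)_n$ in $E^*$, we have $x_n^*(x_n)\to 0$. (d) For every disjoint weakly $p$-summable sequence $(x_n)_n$ in $E$ and every positive disjoint weak* null sequence $(x_n^*)_n$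 in $E^*$, we have $x_n^*(x_n)\to 0$. (e) For every disjoint weakly $p$-summable sequence $(x_n)_n$ in $E$ and every positive weak* null sequence $(x_n^*)_n$ in $E^*$, we have $x_n^*(x_n)\to 0$. -/

import Mathlib

open Filter Topology

section Dual

variable {E : Type*} [NormedAddCommGroup E] [Lattice E] [IsOrderedAddMonoid E] [NormedSpace ℝ E]

/-- The canonical order of the dual of a Banach lattice: `f ≤ g` iff `f x ≤ g x` for every
`x ≥ 0`. -/
instance dualPartialOrder : PartialOrder (StrongDual ℝ E) where
  le f g := ∀ x : E, 0 ≤ x → f x ≤ g x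
  le_refl f x _ := le_refl (f x)
  le_trans f g h hfg hgh x hx := (hfg x hx).trans (hgh x hx)
  le_antisymm f g hfg hgf := by
    ext x
    have key : ∀ y : E, 0 ≤ y → f y = g y := fun y hy => le_antisymm (hfg y hy) (hgf y hy)
    rw [← posPart_sub_negPart x, map_sub, map_sub, key _ (posPart_nonneg x),
      key _ (negPart_nonneg x)]

/-- Two functionals on a Banach lattice are disjoint in the dual lattice: `|f| ∧ |g| = 0`, where
`|f| = f ∨ (-f)`, and the lattice operations are the suprema and infima for the canonical order
of the dual. (By the Riesz-Kantorovich theorem all of these exist.) -/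
def DualDisjoint (f g : StrongDual ℝ E) : Prop :=
  ∃ u v : StrongDual ℝ E, IsLUB {f, -f} u ∧ IsLUB {g, -g} v ∧ IsGLB {u, v} 0

/-- A sequence of pairwise disjoint functionals. -/
def DisjointDualSeq (f : ℕ → StrongDual ℝ E) : Prop :=
  Pairwise fun m n => DualDisjoint (f m) (f n)

end Dual

/-- A sequence of pairwise disjoint elements of a vector lattice: `|x m| ∧ |x n| = 0` for
`m ≠ n`. -/
def DisjointSeq {E : Type*} [AddCommGroup E] [Lattice E] (x : ℕ → E) : Prop :=
  Pairwise fun m n => |x m| ⊓ |x n| = 0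

/-- Every nonempty countable subset that is bounded above has a supremum. -/
def SigmaDedekindComplete (E : Type*) [Lattice E] : Prop :=
  ∀ s : Set E, s.Countable → s.Nonempty → BddAbove s → ∃ a, IsLUB s a

section Space

variable {E : Type*} [NormedAddCommGroup E] [NormedSpace ℝ E]

/-- The scalar sequence `(f (x n))` belongs to `ℓ_p` for every `f` in the dual. -/
def WeaklyPSummable (p : ℝ) (x : ℕ → E) : Prop :=
  ∀ f : StrongDual ℝ E, Summable fun n => |f (x n)| ^ p

/-- The sequence `f` tends to `0` in the weak* topology. -/
def WeakStarNull (f : ℕ → StrongDual ℝ E) : Prop :=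
  Tendsto (fun n => StrongDual.toWeakDual (f n)) atTop (𝓝 0)

/-- A set on which every weak* null sequence converges uniformly to zero. -/
def IsLimitedSet (A : Set E) : Prop :=
  ∀ f : ℕ → StrongDual ℝ E, WeakStarNull f →
    TendstoUniformlyOn (fun n x => f n x) (fun _ => 0) atTop A

end Space

/-- A bounded set on which every disjoint weak* null sequence converges uniformly to zero. -/
def IsAlmostLimitedSet {E : Type*} [NormedAddCommGroup E] [Lattice E] [IsOrderedAddMonoid E]
    [NormedSpace ℝ E] (A : Set E) : Prop :=
  Bornology.IsBounded A ∧
    ∀ f : ℕ → StrongDual ℝ E, DisjointDualSeq f → WeakStarNull f →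
      TendstoUniformlyOn (fun n x => f n x) (fun _ => 0) atTop A

/-- The disjoint Dunford-Pettis* property of order `p`: every disjoint weakly `p`-summable
sequence is limited. -/
def DisjointDPStarP (p : ℝ) (E : Type*) [NormedAddCommGroup E] [Lattice E]
    [NormedSpace ℝ E] : Prop :=
  ∀ x : ℕ → E, DisjointSeq x → WeaklyPSummable p x → IsLimitedSet (Set.range x)

/-!
Only the implication from (d) to (a) is deep, and it holds for each disjoint sequence `x`
separately. If `f` is weak* null, let `g n` be the positive part of the restriction of `f n` to the
band generated by `(x n)⁺`. These functionals are positive and disjoint, `g n` vanishes at `(x n)⁻`,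
and `f n (x n)⁺ ≤ g n (x n)`. If `g` is weak* null, then (d) bounds `f n (x n)⁺` above by a null
sequence. Doing the same with `-f` and `-x` gives `f n (x n) → 0`. This suffices for `x` to be
limited: a failure of uniform convergence on the terms of `x` occurs along strictly increasing
indices, and becomes a diagonal one after reindexing `f` and extending it by zero.

By the Riesz-Kantorovich formula, `g n a` is nearly `f n (z n)` for some `0 ≤ z n ≤ a` in the `n`-th
band, so `g` is weak* null once `f n (z n) → 0` for order bounded disjoint sequences `z`. Here
`σ`-Dedekind completeness enters: `A ↦ f n (sup_{k ∈ A} z k)` is a bounded finitely additive set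
function on `ℕ` which tends to zero on every set `A`, hence so do its values at the singletons
`{n}`. This last step is a form of Phillips' lemma: otherwise there are `ε > 0` and an infinite set
`J` such that for each `n ∈ J` the `n`-th set function is at least `ε` in absolute value at `{n}`
but less than `ε / 3` on the parts of `J` before and after `n`, so it cannot tend to zero on `J`.
-/

section Phillips

open MeasureTheory

variable {α : Type*}

theorem sum_abs_addContent_le {μ : AddContent ℝ (Set.univ : Set (Set α))} {C : ℝ}
    (hC : ∀ A, |μ A| ≤ C) {ι : Type*} (s : Finset ι) {B : ι → Set α}
    (hB : Pairwise (Function.onFun Disjoint B)) : ∑ i ∈ s, |μ (B i)| ≤ 2 * C := by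
  have abs_sum_le (t : Finset ι) : |∑ i ∈ t, μ (B i)| ≤ C := by
    rw [← addContent_biUnion (fun _ _ => Set.mem_univ _) (hB.set_pairwise _) (Set.mem_univ _)]
    exact hC _
  have sum_nonneg_le : ∑ i ∈ s with 0 ≤ μ (B i), |μ (B i)| ≤ C := by
    rw [Finset.sum_congr rfl fun i hi => abs_of_nonneg (Finset.mem_filter.1 hi).2]
    exact (le_abs_self _).trans (abs_sum_le _)
  have sum_neg_le : ∑ i ∈ s with ¬ 0 ≤ μ (B i), |μ (B i)| ≤ C := by
    rw [Finset.sum_congr rfl fun i hi => abs_of_neg (not_le.1 (Finset.mem_filter.1 hi).2),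
      Finset.sum_neg_distrib]
    exact (neg_le_abs _).trans (abs_sum_le _)
  rw [← Finset.sum_filter_add_sum_filter_not s (fun i => 0 ≤ μ (B i))]
  linarith

theorem exists_pairwise_disjoint_infinite_subsets {M : Set α} (hM : M.Infinite) :
    ∃ Q : ℕ → Set α, (∀ i, Q i ⊆ M) ∧ (∀ i, (Q i).Infinite) ∧
      Pairwise (Function.onFun Disjoint Q) := by
  let e : ℕ × ℕ → M := hM.natEmbedding ∘ Nat.pairEquiv
  have he : Function.Injective fun a => (e a : α) := Subtype.val_injective.comp
    (hM.natEmbedding.injective.comp Nat.pairEquiv.injective)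
  refine ⟨fun i => Set.range fun k => (e (i, k) : α), fun i => ?_, fun i => ?_, fun i j hij => ?_⟩
  · rintro _ ⟨k, rfl⟩
    exact (e (i, k)).2
  · exact Set.infinite_range_of_injective (he.comp (Prod.mk_right_injective i))
  · refine Set.disjoint_range_iff.2 fun k l hkl => hij ?_
    exact congrArg Prod.fst (he hkl)

theorem exists_infinite_subset_abs_addContent_lt {μ : AddContent ℝ (Set.univ : Set (Set α))}
    {C δ : ℝ} (hC : ∀ A, |μ A| ≤ C) (hδ : 0 < δ) {M : Set α} (hM : M.Infinite) :
    ∃ M' ⊆ M, M'.Infinite ∧ ∀ B ⊆ M', |μ B| < δ := by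
  obtain ⟨Q, hQM, hQ, hQd⟩ := exists_pairwise_disjoint_infinite_subsets hM
  by_contra! hlarge
  choose B hBQ hδB using fun i => hlarge (Q i) (hQM i) (hQ i)
  have hBd : Pairwise (Function.onFun Disjoint B) := fun i j hij => (hQd hij).mono (hBQ i) (hBQ j)
  have hsummable : Summable fun i => |μ (B i)| :=
    summable_of_sum_le (fun _ => abs_nonneg _) fun s => sum_abs_addContent_le hC s hBd
  obtain ⟨i, hi⟩ := (hsummable.tendsto_atTop_zero.eventually_lt_const hδ).exists
  exact (hδB i).not_gt hi

theorem exists_antitone_infinite_subsets_abs_addContent_lt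
    {μ : ℕ → AddContent ℝ (Set.univ : Set (Set α))} (hbdd : ∀ n, ∃ C, ∀ A, |μ n A| ≤ C)
    {δ : ℝ} (hδ : 0 < δ) {N : Set α} (hN : N.Infinite) :
    ∃ M : ℕ → Set α, Antitone M ∧ (∀ n, M n ⊆ N) ∧ (∀ n, (M n).Infinite) ∧
      ∀ n, ∀ B ⊆ M n, |μ n B| < δ := by
  choose C hC using hbdd
  choose! next hsub hinf hsmall using fun n (M : Set α) (hM : M.Infinite) =>
    exists_infinite_subset_abs_addContent_lt (hC n) hδ hM
  let M : ℕ → Set α := fun n => Nat.rec N next n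
  have hM (n : ℕ) : (M n).Infinite := by
    induction n with
    | zero => exact hN
    | succ n ih => exact hinf n _ ih
  have hanti : Antitone M := antitone_nat_of_succ_le fun n => hsub n _ (hM n)
  exact ⟨fun n => M (n + 1), fun m n hmn => hanti (Nat.succ_le_succ hmn),
    fun n => hanti (Nat.zero_le (n + 1)), fun n => hM (n + 1), fun n => hsmall n _ (hM n)⟩

theorem exists_infinite_subset_abs_addContent_off_diagonal_lt
    {μ : ℕ → AddContent ℝ (Set.univ : Set (Set ℕ))} (hbdd : ∀ n, ∃ C, ∀ A, |μ n A| ≤ C)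
    (hlim : ∀ A, A.Finite → Tendsto (fun n => μ n A) atTop (𝓝 0)) {δ : ℝ} (hδ : 0 < δ)
    {N : Set ℕ} (hN : N.Infinite) :
    ∃ J ⊆ N, J.Infinite ∧
      ∀ n ∈ J, |μ n (J ∩ Set.Iio n)| < δ ∧ |μ n (J ∩ Set.Ioi n)| < δ := by
  obtain ⟨M, hanti, hMN, hM, htail⟩ :=
    exists_antitone_infinite_subsets_abs_addContent_lt hbdd hδ hN
  have hhead (m : ℕ) : ∀ᶠ n in atTop, ∀ B ⊆ Set.Iic m, |μ n B| < δ := by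
    refine (Set.finite_Iic m).finite_subsets.eventually_all.2 fun B hB => ?_
    simpa using (hlim B ((Set.finite_Iic m).subset hB)).abs.eventually_lt_const (by simpa using hδ)
  obtain ⟨j, hjN, hj⟩ := exists_seq_of_forall_finset_exists (· ∈ N)
    (fun m n => m < n ∧ n ∈ M m ∧ ∀ B ⊆ Set.Iic m, |μ n B| < δ) fun s _ => by
      obtain ⟨n, hnM, hn, hlt⟩ := ((Nat.frequently_atTop_iff_infinite.2 (hM (s.sup id)))
        |>.and_eventually ((hhead _).and (eventually_gt_atTop (s.sup id)))).exists
      have hle (m) (hm : m ∈ s) : m ≤ s.sup id := Finset.le_sup (f := id) hm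
      exact ⟨n, hMN _ hnM, fun m hm => ⟨(hle m hm).trans_lt hlt, hanti (hle m hm) hnM,
        fun B hB => hn B (hB.trans (Set.Iic_subset_Iic.2 (hle m hm)))⟩⟩
  have hmono : StrictMono j := fun m n hmn => (hj m n hmn).1
  refine ⟨Set.range j, Set.range_subset_iff.2 hjN, Set.infinite_range_of_injective hmono.injective,
    ?_⟩
  rintro _ ⟨k, rfl⟩
  constructor
  · rcases k with _ | k
    · have hempty : Set.range j ∩ Set.Iio (j 0) = ∅ := by
        rw [Set.eq_empty_iff_forall_notMem]
        rintro _ ⟨⟨i, rfl⟩, hi⟩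
        exact (hmono.monotone (Nat.zero_le i)).not_gt hi
      simpa [hempty] using hδ
    · refine (hj k (k + 1) k.lt_succ_self).2.2 _ ?_
      rintro _ ⟨⟨i, rfl⟩, hi⟩
      exact hmono.monotone (Nat.lt_succ_iff.1 (hmono.lt_iff_lt.1 hi))
  · refine htail _ _ ?_
    rintro _ ⟨⟨i, rfl⟩, hi⟩
    exact (hj k i (hmono.lt_iff_lt.1 hi)).2.1

theorem tendsto_addContent_diagonal {μ : ℕ → AddContent ℝ (Set.univ : Set (Set ℕ))}
    (hbdd : ∀ n, ∃ C, ∀ A, |μ n A| ≤ C) (hlim : ∀ A, Tendsto (fun n => μ n A) atTop (𝓝 0)) :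
    Tendsto (fun n => μ n {n}) atTop (𝓝 0) := by
  have hsmall (A : Set ℕ) {δ : ℝ} (hδ : 0 < δ) : ∀ᶠ n in atTop, |μ n A| < δ := by
    simpa using (hlim A).abs.eventually_lt_const (by simpa using hδ)
  by_contra hcon
  obtain ⟨ε, hε, hfreq⟩ : ∃ ε > 0, ∃ᶠ n in atTop, ε ≤ |μ n {n}| := by
    simpa only [Metric.tendsto_nhds, dist_zero_right, Real.norm_eq_abs, not_forall, exists_prop,
      not_eventually, not_lt] using hcon
  obtain ⟨J, hJε, hJ, hoff⟩ := exists_infinite_subset_abs_addContent_off_diagonal_lt hbdd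
    (fun A _ => hlim A) (show 0 < ε / 3 by positivity) (Nat.frequently_atTop_iff_infinite.1 hfreq)
  obtain ⟨n, (hnJ : n ∈ J), hn⟩ := ((Nat.frequently_atTop_iff_infinite.2 hJ).and_eventually
    (hsmall J (show 0 < ε / 3 by positivity))).exists
  obtain ⟨hhead, htail⟩ := hoff n hnJ
  have hsplit : μ n J = μ n (J ∩ Set.Iio n) + μ n {n} + μ n (J ∩ Set.Ioi n) := by
    have hJn : J = J ∩ Set.Iio n ∪ {n} ∪ J ∩ Set.Ioi n := by grind
    conv_lhs => rw [hJn]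
    rw [addContent_union', addContent_union'] <;> first | exact Set.mem_univ _ | grind
  have hdiag : ε ≤ |μ n {n}| := hJε hnJ
  grind

end Phillips

section LatticeOrderedGroup

open MeasureTheory

theorem inf_eq_zero_of_le {E : Type*} [Zero E] [Lattice E] {a b c d : E}
    (hc : 0 ≤ c) (hd : 0 ≤ d) (hca : c ≤ a) (hdb : d ≤ b) (hab : a ⊓ b = 0) : c ⊓ d = 0 :=
  le_antisymm (hab ▸ inf_le_inf hca hdb) (le_inf hc hd)

theorem DisjointSeq.neg {E : Type*} [AddCommGroup E] [Lattice E] {x : ℕ → E}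
    (hx : DisjointSeq x) : DisjointSeq (-x) := by
  simpa only [DisjointSeq, Pi.neg_apply, abs_neg] using hx

variable {E : Type*} [AddCommGroup E] [Lattice E] [IsOrderedAddMonoid E]

theorem DisjointSeq.posPart_inf_posPart {x : ℕ → E} (hx : DisjointSeq x) :
    Pairwise fun m n => (x m)⁺ ⊓ (x n)⁺ = 0 := fun _ _ hmn =>
  inf_eq_zero_of_le (posPart_nonneg _) (posPart_nonneg _) (sup_le (le_abs_self _) (abs_nonneg _))
    (sup_le (le_abs_self _) (abs_nonneg _)) (hx hmn)

theorem add_inf_eq_zero {a b c : E} (hac : a ⊓ c = 0) (hbc : b ⊓ c = 0) : (a + b) ⊓ c = 0 := by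
  have ha : 0 ≤ a := hac ▸ inf_le_left
  have hb : 0 ≤ b := hbc ▸ inf_le_left
  have hc : 0 ≤ c := hac ▸ inf_le_right
  refine le_antisymm ?_ (le_inf (add_nonneg ha hb) hc)
  have hle : (a + b) ⊓ c ≤ a + b ⊓ c := by
    rw [add_inf]
    exact inf_le_inf_left _ (le_add_of_nonneg_left ha)
  rw [hbc, add_zero] at hle
  exact hac ▸ le_inf hle inf_le_right

theorem sup_eq_add_of_inf_eq_zero {a b : E} (hab : a ⊓ b = 0) : a ⊔ b = a + b := by
  rw [← inf_add_sup a b, hab, zero_add]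

theorem inf_eq_zero_of_isLUB {s : Set E} {a b : E} (ha : IsLUB s a) (hs : s.Nonempty)
    (hb : ∀ z ∈ s, z ⊓ b = 0) : a ⊓ b = 0 := by
  obtain ⟨z₀, hz₀⟩ := hs
  have hab : 0 ≤ a ⊓ b := hb z₀ hz₀ ▸ inf_le_inf_right b (ha.1 hz₀)
  have hub : a ≤ a - a ⊓ b := ha.2 fun z hz => by
    have hz0 : 0 ≤ z := hb z hz ▸ inf_le_left
    rw [le_sub_iff_add_le, ← sup_eq_add_of_inf_eq_zero
      (inf_eq_zero_of_le hz0 hab le_rfl inf_le_right (hb z hz))]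
    exact sup_le (ha.1 hz) inf_le_left
  exact le_antisymm (by simpa using hub) hab

/-- The positive cone of the double disjoint complement of `y ≥ 0`, which is the band generated by
`y` when `E` is Archimedean. Functionals are restricted to it to be made disjoint. -/
def positiveBand (y : E) : AddSubmonoid E where
  carrier := {z | 0 ≤ z ∧ ∀ w, y ⊓ w = 0 → z ⊓ w = 0}
  zero_mem' := ⟨le_rfl, fun _ hw => inf_eq_left.2 (hw ▸ inf_le_right)⟩
  add_mem' := fun ⟨ha, ha'⟩ ⟨hb, hb'⟩ =>
    ⟨add_nonneg ha hb, fun w hw => add_inf_eq_zero (ha' w hw) (hb' w hw)⟩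

theorem self_mem_positiveBand {y : E} (hy : 0 ≤ y) : y ∈ positiveBand y :=
  ⟨hy, fun _ hw => hw⟩

theorem mem_positiveBand_of_le {y a b : E} (ha : 0 ≤ a) (hab : a ≤ b) (hb : b ∈ positiveBand y) :
    a ∈ positiveBand y :=
  ⟨ha, fun w hw => inf_eq_zero_of_le ha (hw ▸ inf_le_right) hab le_rfl (hb.2 w hw)⟩

theorem inf_eq_zero_of_mem_positiveBand {y w a b : E} (hyw : y ⊓ w = 0) (ha : a ∈ positiveBand y)
    (hb : b ∈ positiveBand w) : a ⊓ b = 0 := by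
  rw [inf_comm]
  refine hb.2 a ?_
  rw [inf_comm]
  exact ha.2 w hyw

theorem SigmaDedekindComplete.exists_addContent (hE : SigmaDedekindComplete E) {ι : Type*}
    [Countable ι] {z : ι → E} {x : E} (hx : 0 ≤ x) (hz : ∀ i, z i ∈ Set.Icc 0 x)
    (hd : Pairwise fun i j => z i ⊓ z j = 0) :
    ∃ s : AddContent E (Set.univ : Set (Set ι)),
      (∀ A, s A ∈ Set.Icc 0 x) ∧ ∀ i, s {i} = z i := by
  have hub (A : Set ι) : x ∈ upperBounds (insert 0 (z '' A)) := by
    rintro _ (rfl | ⟨i, -, rfl⟩)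
    exacts [hx, (hz i).2]
  choose s hs using fun A : Set ι =>
    hE _ ((A.to_countable.image z).insert 0) (Set.insert_nonempty _ _) ⟨x, hub A⟩
  have hempty : s ∅ = 0 := (hs ∅).unique (by simp)
  have hsingleton (i : ι) : s {i} = z i := (hs {i}).unique <| by
    simpa [sup_eq_right.2 (hz i).1] using isLUB_pair (a := 0) (b := z i)
  have hdisj {A B : Set ι} (hAB : Disjoint A B) : s A ⊓ s B = 0 := by
    refine inf_eq_zero_of_isLUB (hs A) (Set.insert_nonempty _ _) fun a ha => ?_
    rw [inf_comm]
    refine inf_eq_zero_of_isLUB (hs B) (Set.insert_nonempty _ _) fun b hb => ?_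
    rcases ha with rfl | ⟨i, hi, rfl⟩ <;> rcases hb with rfl | ⟨j, hj, rfl⟩
    · exact inf_idem _
    · exact inf_eq_right.2 (hz j).1
    · exact inf_eq_left.2 (hz i).1
    · exact hd fun hji => Set.disjoint_left.1 hAB hi (hji ▸ hj)
  have hunion {A B : Set ι} (hAB : Disjoint A B) : s (A ∪ B) = s A + s B := by
    rw [← sup_eq_add_of_inf_eq_zero (hdisj hAB)]
    refine (hs (A ∪ B)).unique ?_
    simpa only [← Set.insert_union_distrib, ← Set.image_union] using (hs A).union (hs B)
  have huniv : IsSetRing (Set.univ : Set (Set ι)) := ⟨trivial, by simp, by simp⟩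
  refine ⟨huniv.addContent_of_union s hempty fun _ _ => hunion,
    fun A => ⟨(hs A).1 (Set.mem_insert _ _), (hs A).2 (hub A)⟩, hsingleton⟩

end LatticeOrderedGroup

section WeakStar

variable {E : Type*} [NormedAddCommGroup E] [NormedSpace ℝ E]

theorem weakStarNull_iff {f : ℕ → StrongDual ℝ E} :
    WeakStarNull f ↔ ∀ x, Tendsto (fun n => f n x) atTop (𝓝 0) :=
  tendsto_iff_forall_eval_tendsto_topDualPairing

theorem WeakStarNull.neg {f : ℕ → StrongDual ℝ E} (hf : WeakStarNull f) : WeakStarNull (-f) :=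
  weakStarNull_iff.2 fun x => by simpa using (weakStarNull_iff.1 hf x).neg

theorem WeakStarNull.comp_strictMono {f : ℕ → StrongDual ℝ E} (hf : WeakStarNull f) {φ : ℕ → ℕ}
    (hφ : StrictMono φ) : WeakStarNull (f ∘ φ) :=
  weakStarNull_iff.2 fun x => (weakStarNull_iff.1 hf x).comp hφ.tendsto_atTop

theorem WeakStarNull.extend_zero {f : ℕ → StrongDual ℝ E} (hf : WeakStarNull f) {φ : ℕ → ℕ}
    (hφ : Function.Injective φ) : WeakStarNull (Function.extend φ f 0) := by
  refine weakStarNull_iff.2 fun x => ?_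
  have hfx := weakStarNull_iff.1 hf x
  rw [← Nat.cofinite_eq_atTop] at hfx ⊢
  intro U hU
  refine ((hfx hU).image φ).subset fun n hn => ?_
  rcases em (∃ k, φ k = n) with ⟨k, rfl⟩ | hrange
  · refine ⟨k, ?_, rfl⟩
    simpa [hφ.extend_apply] using hn
  · refine absurd (mem_of_mem_nhds hU) ?_
    simpa [Function.extend_apply' _ _ _ hrange] using hn

theorem tendsto_diagonal_of_tendstoUniformlyOn_range {x : ℕ → E} {f : ℕ → StrongDual ℝ E}
    (h : TendstoUniformlyOn (fun n y => f n y) (fun _ => 0) atTop (Set.range x)) :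
    Tendsto (fun n => f n (x n)) atTop (𝓝 0) := by
  rw [Metric.tendsto_nhds]
  intro ε hε
  filter_upwards [Metric.tendstoUniformlyOn_iff.1 h ε hε] with n hn
  rw [dist_comm]
  exact hn _ ⟨n, rfl⟩

theorem WeakStarNull.exists_strictMono_le_abs {f : ℕ → StrongDual ℝ E} (hf : WeakStarNull f)
    {x : ℕ → E} {ε : ℝ} (hε : 0 < ε) (hfreq : ∃ᶠ n in atTop, ∃ k, ε ≤ |f n (x k)|) :
    ∃ φ ψ : ℕ → ℕ, StrictMono φ ∧ StrictMono ψ ∧ ∀ i, ε ≤ |f (φ i) (x (ψ i))| := by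
  obtain ⟨q, hq, hlt⟩ := exists_seq_of_forall_finset_exists
    (fun q : ℕ × ℕ => ε ≤ |f q.1 (x q.2)|) (fun q r => q.1 < r.1 ∧ q.2 < r.2) fun s _ => by
      have hsmall : ∀ᶠ n in atTop, ∀ k ∈ Set.Iic (s.sup Prod.snd), |f n (x k)| < ε :=
        (Set.finite_Iic _).eventually_all.2 fun k _ => by
          simpa using (weakStarNull_iff.1 hf (x k)).abs.eventually_lt_const (by simpa using hε)
      obtain ⟨n, ⟨k, hk⟩, hn, hlt⟩ :=
        (hfreq.and_eventually (hsmall.and (eventually_gt_atTop (s.sup Prod.fst)))).exists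
      have hk' : s.sup Prod.snd < k := not_le.1 fun hle => (hn k hle).not_ge hk
      exact ⟨(n, k), hk, fun q hq =>
        ⟨(Finset.le_sup hq).trans_lt hlt, (Finset.le_sup hq).trans_lt hk'⟩⟩
  exact ⟨fun i => (q i).1, fun i => (q i).2, fun i j hij => (hlt i j hij).1,
    fun i j hij => (hlt i j hij).2, hq⟩

theorem isLimitedSet_range_iff {x : ℕ → E} :
    IsLimitedSet (Set.range x) ↔
      ∀ f : ℕ → StrongDual ℝ E, WeakStarNull f → Tendsto (fun n => f n (x n)) atTop (𝓝 0) := by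
  refine ⟨fun h f hf => tendsto_diagonal_of_tendstoUniformlyOn_range (h f hf), fun h f hf => ?_⟩
  by_contra hcon
  obtain ⟨ε, hε, hfreq⟩ : ∃ ε > 0, ∃ᶠ n in atTop, ∃ k, ε ≤ |f n (x k)| := by
    simpa only [Metric.tendstoUniformlyOn_iff, Set.forall_mem_range, dist_zero_left,
      Real.norm_eq_abs, not_forall, exists_prop, not_eventually, not_lt] using hcon
  obtain ⟨φ, ψ, hφ, hψ, hε_le⟩ := hf.exists_strictMono_le_abs hε hfreq
  have hnull := h _ ((hf.comp_strictMono hφ).extend_zero hψ.injective)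
  obtain ⟨i, hi⟩ := ((hnull.comp hψ.tendsto_atTop).abs.eventually_lt_const
    (show |(0 : ℝ)| < ε by simpa using hε)).exists
  rw [Function.comp_apply, hψ.injective.extend_apply] at hi
  exact hi.not_ge (hε_le i)

theorem IsLimitedSet.isBounded {A : Set E} (hA : IsLimitedSet A) : Bornology.IsBounded A := by
  have hweak (f : StrongDual ℝ E) : ∃ C, ∀ x : A, ‖f x‖ ≤ C := by
    have hnull : WeakStarNull fun n : ℕ => (1 / ((n : ℝ) + 1)) • f := weakStarNull_iff.2 fun x => by
      simpa using (tendsto_one_div_add_atTop_nhds_zero_nat (𝕜 := ℝ)).mul_const (f x)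
    obtain ⟨n, hn⟩ := (Metric.tendstoUniformlyOn_iff.1 (hA _ hnull) 1 one_pos).exists
    refine ⟨(n : ℝ) + 1, fun x => ?_⟩
    have hpos : (0 : ℝ) < n + 1 := by positivity
    have hx : ‖(1 / ((n : ℝ) + 1)) • f x‖ < 1 := by simpa using hn x x.2
    rw [norm_smul, Real.norm_of_nonneg (by positivity), one_div_mul_eq_div, div_lt_one hpos] at hx
    exact hx.le
  obtain ⟨C, hC⟩ := banach_steinhaus
    (g := fun x : A => NormedSpace.inclusionInDoubleDualLi ℝ (x : E)) hweak
  exact isBounded_iff_forall_norm_le.2 ⟨C, fun x hx =>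
    ((NormedSpace.inclusionInDoubleDualLi ℝ).norm_map x).symm.trans_le (hC ⟨x, hx⟩)⟩

end WeakStar

section RieszKantorovich

open Pointwise

theorem addSubmonoid_inter_Iic_add {E : Type*} [AddCommGroup E] [Lattice E] [IsOrderedAddMonoid E]
    {I : AddSubmonoid E} (hpos : ∀ z ∈ I, 0 ≤ z) (hlower : ∀ z ∈ I, ∀ w, 0 ≤ w → w ≤ z → w ∈ I)
    {a b : E} (ha : 0 ≤ a) (hb : 0 ≤ b) :
    (I : Set E) ∩ Set.Iic (a + b) = (I : Set E) ∩ Set.Iic a + (I : Set E) ∩ Set.Iic b := by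
  refine Set.Subset.antisymm ?_ ?_
  · rintro z ⟨hz, hzab⟩
    have hinf : 0 ≤ z ⊓ a := le_inf (hpos z hz) ha
    have hsub : z - z ⊓ a ≤ b := by
      rw [sub_le_comm]
      exact le_inf (sub_le_self z hb) (sub_le_iff_le_add.2 hzab)
    exact ⟨z ⊓ a, ⟨hlower z hz _ hinf inf_le_left, inf_le_right⟩, z - z ⊓ a,
      ⟨hlower z hz _ (sub_nonneg.2 inf_le_left) (sub_le_self z hinf), hsub⟩, add_sub_cancel _ _⟩
  · rintro _ ⟨z, ⟨hz, hza⟩, w, ⟨hw, hwb⟩, rfl⟩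
    exact ⟨I.add_mem hz hw, add_le_add hza hwb⟩

variable {E : Type*} [NormedAddCommGroup E] [Lattice E] [IsOrderedAddMonoid E] [NormedSpace ℝ E]

theorem isLUB_pair_neg_of_nonneg {f : StrongDual ℝ E} (hf : 0 ≤ f) : IsLUB {f, -f} f := by
  refine IsGreatest.isLUB ⟨Set.mem_insert _ _, ?_⟩
  rintro g (rfl | rfl)
  exacts [le_rfl, fun x hx => neg_le_self (hf x hx)]

theorem dualDisjoint_of_forall_exists_le {f g : StrongDual ℝ E} (hf : 0 ≤ f) (hg : 0 ≤ g)
    (h : ∀ x, 0 ≤ x → ∀ ε > 0, ∃ z ∈ Set.Icc 0 x, f (x - z) + g z ≤ ε) : DualDisjoint f g := by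
  refine ⟨f, g, isLUB_pair_neg_of_nonneg hf, isLUB_pair_neg_of_nonneg hg, ?_, fun k hk x hx => ?_⟩
  · rintro k (rfl | rfl)
    exacts [hf, hg]
  refine le_of_forall_pos_le_add fun ε hε => ?_
  obtain ⟨z, ⟨hz, hzx⟩, hzε⟩ := h x hx ε hε
  have hkf : k (x - z) ≤ f (x - z) := hk (Set.mem_insert f _) _ (sub_nonneg.2 hzx)
  have hkg : k z ≤ g z := hk (Set.mem_insert_of_mem f rfl) _ hz
  calc k x = k (x - z) + k z := by rw [← map_add, sub_add_cancel]
    _ ≤ f (x - z) + g z := add_le_add hkf hkg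
    _ ≤ 0 + ε := by rwa [zero_add]

theorem weakStarNull_of_tendsto_of_nonneg {f : ℕ → StrongDual ℝ E}
    (hf : ∀ x, 0 ≤ x → Tendsto (fun n => f n x) atTop (𝓝 0)) : WeakStarNull f :=
  weakStarNull_iff.2 fun x => by
    simpa only [← map_sub, posPart_sub_negPart, sub_zero] using
      (hf _ (posPart_nonneg x)).sub (hf _ (negPart_nonneg x))

variable [HasSolidNorm E]

theorem exists_strongDual_eq_of_add {φ : E → ℝ} {C : ℝ}
    (hadd : ∀ a b, 0 ≤ a → 0 ≤ b → φ (a + b) = φ a + φ b) (hC : ∀ a, 0 ≤ a → |φ a| ≤ C * ‖a‖) :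
    ∃ g : StrongDual ℝ E, ∀ a, 0 ≤ a → g a = φ a := by
  have hsub {a b c d : E} (ha : 0 ≤ a) (hb : 0 ≤ b) (hc : 0 ≤ c) (hd : 0 ≤ d)
      (h : a - b = c - d) : φ a - φ b = φ c - φ d := by
    rw [sub_eq_sub_iff_add_eq_add] at h ⊢
    rw [← hadd a d ha hd, ← hadd c b hc hb, h]
  let F : E →+ ℝ := AddMonoidHom.mk' (fun x => φ x⁺ - φ x⁻) fun a b => by
    rw [← add_sub_add_comm, ← hadd _ _ (posPart_nonneg a) (posPart_nonneg b),
      ← hadd _ _ (negPart_nonneg a) (negPart_nonneg b)]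
    refine hsub (posPart_nonneg _) (negPart_nonneg _)
      (add_nonneg (posPart_nonneg a) (posPart_nonneg b))
      (add_nonneg (negPart_nonneg a) (negPart_nonneg b)) ?_
    simp only [add_sub_add_comm, posPart_sub_negPart]
  have hF (a : E) (ha : 0 ≤ a) : F a = φ a := by
    have hzero : φ 0 = 0 := by simpa using hadd 0 0 le_rfl le_rfl
    simp [F, posPart_of_nonneg ha, negPart_of_nonneg ha, hzero]
  have hbound (x : E) : ‖F x‖ ≤ 2 * |C| * ‖x‖ := by
    have hle {a : E} (ha : 0 ≤ a) (hax : a ≤ |x|) : |φ a| ≤ |C| * ‖x‖ :=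
      (hC a ha).trans <| mul_le_mul (le_abs_self C)
        (norm_le_norm_of_abs_le_abs (by rwa [abs_of_nonneg ha])) (norm_nonneg a) (abs_nonneg C)
    have hpos : |φ x⁺| ≤ |C| * ‖x‖ := hle (posPart_nonneg x)
      (posPart_add_negPart x ▸ le_add_of_nonneg_right (negPart_nonneg x))
    have hneg : |φ x⁻| ≤ |C| * ‖x‖ := hle (negPart_nonneg x)
      (posPart_add_negPart x ▸ le_add_of_nonneg_left (posPart_nonneg x))
    calc ‖F x‖ ≤ |φ x⁺| + |φ x⁻| := abs_sub _ _
      _ ≤ 2 * |C| * ‖x‖ := by linarith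
  exact ⟨F.toRealLinearMap (AddMonoidHomClass.continuous_of_bound F _ hbound), hF⟩

theorem abs_apply_le_of_mem_Icc (f : StrongDual ℝ E) {x z : E} (hz : z ∈ Set.Icc 0 x) :
    |f z| ≤ ‖f‖ * ‖x‖ := by
  refine (f.le_opNorm z).trans (mul_le_mul_of_nonneg_left ?_ (norm_nonneg f))
  refine norm_le_norm_of_abs_le_abs ?_
  rw [abs_of_nonneg hz.1, abs_of_nonneg (hz.1.trans hz.2)]
  exact hz.2

theorem exists_isLUB_image_inter_Iic (f : StrongDual ℝ E) {I : AddSubmonoid E}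
    (hpos : ∀ z ∈ I, 0 ≤ z) (hlower : ∀ z ∈ I, ∀ w, 0 ≤ w → w ≤ z → w ∈ I) :
    ∃ g : StrongDual ℝ E, ∀ x, 0 ≤ x → IsLUB (f '' (I ∩ Set.Iic x)) (g x) := by
  have hub {x : E} : ‖f‖ * ‖x‖ ∈ upperBounds (f '' (I ∩ Set.Iic x)) := by
    rintro _ ⟨z, ⟨hz, hzx⟩, rfl⟩
    exact (le_abs_self _).trans (abs_apply_le_of_mem_Icc f ⟨hpos z hz, hzx⟩)
  have hzero {x : E} (hx : 0 ≤ x) : (0 : ℝ) ∈ f '' (I ∩ Set.Iic x) :=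
    ⟨0, ⟨I.zero_mem, hx⟩, map_zero f⟩
  have hLUB {x : E} (hx : 0 ≤ x) : IsLUB (f '' (I ∩ Set.Iic x)) (sSup (f '' (I ∩ Set.Iic x))) :=
    isLUB_csSup ⟨0, hzero hx⟩ ⟨_, hub⟩
  obtain ⟨g, hg⟩ := exists_strongDual_eq_of_add (φ := fun x => sSup (f '' (I ∩ Set.Iic x)))
    (fun a b ha hb => (hLUB (add_nonneg ha hb)).unique <| by
      rw [addSubmonoid_inter_Iic_add hpos hlower ha hb, Set.image_add]
      exact (hLUB ha).add (hLUB hb))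
    (fun a ha => (abs_of_nonneg ((hLUB ha).1 (hzero ha))).trans_le ((hLUB ha).2 hub))
  exact ⟨g, fun x hx => hg x hx ▸ hLUB hx⟩

/-- The positive part of the restriction of `f` to the band generated by `y`: the least positive
functional dominating `f` on `positiveBand y`. Its value at `x ≥ 0` is the Riesz-Kantorovich
supremum of `f z` over `0 ≤ z ≤ x` in that band. -/
noncomputable def bandPosPart (f : StrongDual ℝ E) (y : E) : StrongDual ℝ E :=
  (exists_isLUB_image_inter_Iic f (I := positiveBand y) (fun _ hz => hz.1)
    fun _ hz _ hw hwz => mem_positiveBand_of_le hw hwz hz).choose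

theorem isLUB_bandPosPart (f : StrongDual ℝ E) (y : E) {x : E} (hx : 0 ≤ x) :
    IsLUB (f '' (positiveBand y ∩ Set.Iic x)) (bandPosPart f y x) :=
  (exists_isLUB_image_inter_Iic f (I := positiveBand y) (fun _ hz => hz.1)
    fun _ hz _ hw hwz => mem_positiveBand_of_le hw hwz hz).choose_spec x hx

theorem bandPosPart_nonneg (f : StrongDual ℝ E) (y : E) : 0 ≤ bandPosPart f y :=
  fun _ hx => (isLUB_bandPosPart f y hx).1 ⟨0, ⟨zero_mem _, hx⟩, map_zero f⟩

theorem apply_le_bandPosPart (f : StrongDual ℝ E) {y z : E} (hz : z ∈ positiveBand y) :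
    f z ≤ bandPosPart f y z :=
  (isLUB_bandPosPart f y hz.1).1 ⟨z, ⟨hz, le_rfl⟩, rfl⟩

theorem bandPosPart_eq_zero (f : StrongDual ℝ E) {y w x : E} (hyw : y ⊓ w = 0)
    (hx : x ∈ positiveBand w) : bandPosPart f y x = 0 := by
  have hzero : (positiveBand y : Set E) ∩ Set.Iic x = {0} := by
    refine Set.Subset.antisymm ?_ (Set.singleton_subset_iff.2 ⟨zero_mem _, hx.1⟩)
    rintro z ⟨hz, hzx⟩
    exact (inf_eq_left.2 hzx).symm.trans (inf_eq_zero_of_mem_positiveBand hyw hz hx)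
  refine (isLUB_bandPosPart f y hx.1).unique ?_
  rw [hzero, Set.image_singleton, map_zero]
  exact isLUB_singleton

theorem exists_mem_positiveBand_bandPosPart_lt (f : StrongDual ℝ E) (y : E) {x : E} (hx : 0 ≤ x)
    {ε : ℝ} (hε : 0 < ε) :
    ∃ z ∈ positiveBand y, z ∈ Set.Icc 0 x ∧ bandPosPart f y x < f z + ε := by
  obtain ⟨_, ⟨z, ⟨hz, hzx⟩, rfl⟩, hlt, -⟩ :=
    (isLUB_bandPosPart f y hx).exists_between (sub_lt_self _ hε)
  exact ⟨z, hz, ⟨hz.1, hzx⟩, sub_lt_iff_lt_add.1 hlt⟩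

theorem dualDisjoint_bandPosPart (f g : StrongDual ℝ E) {y w : E} (hyw : y ⊓ w = 0) :
    DualDisjoint (bandPosPart f y) (bandPosPart g w) := by
  refine dualDisjoint_of_forall_exists_le (bandPosPart_nonneg f y) (bandPosPart_nonneg g w)
    fun x hx ε hε => ?_
  obtain ⟨z, hz, hzx, hlt⟩ := exists_mem_positiveBand_bandPosPart_lt f y hx hε
  refine ⟨z, hzx, ?_⟩
  rw [bandPosPart_eq_zero g (inf_comm y w ▸ hyw) hz, add_zero, map_sub, sub_le_iff_le_add]
  linarith [apply_le_bandPosPart f hz]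

theorem SigmaDedekindComplete.tendsto_apply_of_disjoint (hE : SigmaDedekindComplete E)
    {f : ℕ → StrongDual ℝ E} (hf : WeakStarNull f) {z : ℕ → E} {x : E}
    (hz : ∀ n, z n ∈ Set.Icc 0 x) (hd : Pairwise fun m n => z m ⊓ z n = 0) :
    Tendsto (fun n => f n (z n)) atTop (𝓝 0) := by
  obtain ⟨s, hs, hsz⟩ := hE.exists_addContent ((hz 0).1.trans (hz 0).2) hz hd
  let μ (n : ℕ) : MeasureTheory.AddContent ℝ (Set.univ : Set (Set ℕ)) :=
    { toFun := fun A => f n (s A)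
      empty' := by simp
      sUnion' := fun I hI hId hU => by rw [MeasureTheory.addContent_sUnion hI hId hU, map_sum] }
  have hdiag : Tendsto (fun n => μ n {n}) atTop (𝓝 0) :=
    tendsto_addContent_diagonal (fun n => ⟨‖f n‖ * ‖x‖, fun A => abs_apply_le_of_mem_Icc _ (hs A)⟩)
      fun A => weakStarNull_iff.1 hf (s A)
  exact hdiag.congr fun n => congrArg (f n) (hsz n)

theorem SigmaDedekindComplete.weakStarNull_bandPosPart (hE : SigmaDedekindComplete E)
    {f : ℕ → StrongDual ℝ E} (hf : WeakStarNull f) {y : ℕ → E}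
    (hd : Pairwise fun m n => y m ⊓ y n = 0) : WeakStarNull fun n => bandPosPart (f n) (y n) := by
  refine weakStarNull_of_tendsto_of_nonneg fun x hx => ?_
  choose z hz hzx hlt using fun n : ℕ => exists_mem_positiveBand_bandPosPart_lt (f n) (y n) hx
    (Nat.one_div_pos_of_nat (α := ℝ) (n := n))
  have hlim : Tendsto (fun n => f n (z n)) atTop (𝓝 0) :=
    hE.tendsto_apply_of_disjoint hf hzx fun m n hmn =>
      inf_eq_zero_of_mem_positiveBand (hd hmn) (hz m) (hz n)
  refine squeeze_zero (fun n => bandPosPart_nonneg (f n) (y n) x hx) (fun n => (hlt n).le) ?_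
  simpa using hlim.add (tendsto_one_div_add_atTop_nhds_zero_nat (𝕜 := ℝ))

end RieszKantorovich

section Characterization

variable {E : Type*} [NormedAddCommGroup E] [Lattice E] [IsOrderedAddMonoid E] [NormedSpace ℝ E]
  [HasSolidNorm E]

theorem SigmaDedekindComplete.exists_pos_disjoint_majorant (hE : SigmaDedekindComplete E)
    {x : ℕ → E} (hx : DisjointSeq x) {f : ℕ → StrongDual ℝ E} (hf : WeakStarNull f) :
    ∃ g : ℕ → StrongDual ℝ E, (∀ n, 0 ≤ g n) ∧ DisjointDualSeq g ∧ WeakStarNull g ∧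
      ∀ n, f n (x n)⁺ ≤ g n (x n) := by
  refine ⟨fun n => bandPosPart (f n) (x n)⁺, fun n => bandPosPart_nonneg _ _,
    fun m n hmn => dualDisjoint_bandPosPart _ _ (hx.posPart_inf_posPart hmn),
    hE.weakStarNull_bandPosPart hf hx.posPart_inf_posPart, fun n => ?_⟩
  calc f n (x n)⁺ ≤ bandPosPart (f n) (x n)⁺ (x n)⁺ :=
        apply_le_bandPosPart _ (self_mem_positiveBand (posPart_nonneg _))
    _ = bandPosPart (f n) (x n)⁺ ((x n)⁺ - (x n)⁻) := by
        rw [map_sub, bandPosPart_eq_zero _ (posPart_inf_negPart_eq_zero _)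
          (self_mem_positiveBand (negPart_nonneg _)), sub_zero]
    _ = bandPosPart (f n) (x n)⁺ (x n) := by rw [posPart_sub_negPart]

theorem SigmaDedekindComplete.tendsto_apply_posPart_of_pos_disjoint (hE : SigmaDedekindComplete E)
    {x : ℕ → E} (hx : DisjointSeq x)
    (hnull : ∀ g : ℕ → StrongDual ℝ E, (∀ n, 0 ≤ g n) → DisjointDualSeq g → WeakStarNull g →
      Tendsto (fun n => g n (x n)) atTop (𝓝 0))
    {f : ℕ → StrongDual ℝ E} (hf : WeakStarNull f) :
    Tendsto (fun n => f n (x n)⁺) atTop (𝓝 0) := by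
  obtain ⟨g, hg, hgd, hgn, hfg⟩ := hE.exists_pos_disjoint_majorant hx hf
  obtain ⟨k, hk, hkd, hkn, hfk⟩ := hE.exists_pos_disjoint_majorant hx hf.neg
  exact tendsto_of_tendsto_of_tendsto_of_le_of_le (by simpa using (hnull k hk hkd hkn).neg)
    (hnull g hg hgd hgn) (fun n => neg_le.1 (hfk n)) hfg

theorem SigmaDedekindComplete.tendsto_apply_of_pos_disjoint (hE : SigmaDedekindComplete E)
    {x : ℕ → E} (hx : DisjointSeq x)
    (hnull : ∀ g : ℕ → StrongDual ℝ E, (∀ n, 0 ≤ g n) → DisjointDualSeq g → WeakStarNull g →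
      Tendsto (fun n => g n (x n)) atTop (𝓝 0))
    {f : ℕ → StrongDual ℝ E} (hf : WeakStarNull f) :
    Tendsto (fun n => f n (x n)) atTop (𝓝 0) := by
  have hpos : Tendsto (fun n => f n (x n)⁺) atTop (𝓝 0) :=
    hE.tendsto_apply_posPart_of_pos_disjoint hx hnull hf
  have hneg : Tendsto (fun n => f n (x n)⁻) atTop (𝓝 0) := by
    have hnull_neg (g : ℕ → StrongDual ℝ E) (hg : ∀ n, 0 ≤ g n) (hgd : DisjointDualSeq g)
        (hgn : WeakStarNull g) : Tendsto (fun n => g n ((-x) n)) atTop (𝓝 0) := by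
      simpa using (hnull g hg hgd hgn).neg
    simpa only [Pi.neg_apply, posPart_neg] using
      hE.tendsto_apply_posPart_of_pos_disjoint hx.neg hnull_neg hf
  simpa only [← map_sub, posPart_sub_negPart, sub_zero] using hpos.sub hneg

theorem theorem3p4_general (hE : SigmaDedekindComplete E) {x : ℕ → E} (hx : DisjointSeq x) :
    List.TFAE [
      IsLimitedSet (Set.range x),
      IsAlmostLimitedSet (Set.range x),
      ∀ f : ℕ → StrongDual ℝ E, DisjointDualSeq f → WeakStarNull f →
        Tendsto (fun n => f n (x n)) atTop (𝓝 0),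
      ∀ f : ℕ → StrongDual ℝ E, (∀ n, 0 ≤ f n) → DisjointDualSeq f → WeakStarNull f →
        Tendsto (fun n => f n (x n)) atTop (𝓝 0),
      ∀ f : ℕ → StrongDual ℝ E, (∀ n, 0 ≤ f n) → WeakStarNull f →
        Tendsto (fun n => f n (x n)) atTop (𝓝 0)] := by
  tfae_have 1 → 2 := fun h => ⟨h.isBounded, fun f _ hf => h f hf⟩
  tfae_have 2 → 3 := fun h f hfd hf => tendsto_diagonal_of_tendstoUniformlyOn_range (h.2 f hfd hf)
  tfae_have 3 → 4 := fun h f _ hfd hf => h f hfd hf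
  tfae_have 4 → 1 := fun h => isLimitedSet_range_iff.2 fun _ hf =>
    hE.tendsto_apply_of_pos_disjoint hx h hf
  tfae_have 1 → 5 := fun h f _ hf => isLimitedSet_range_iff.1 h f hf
  tfae_have 5 → 4 := fun h f hpos _ hf => h f hpos hf
  tfae_finish

end Characterization

theorem theorem3p4 {E : Type*} [NormedAddCommGroup E] [Lattice E] [IsOrderedAddMonoid E]
    [NormedSpace ℝ E] [IsOrderedModule ℝ E] [HasSolidNorm E] [CompleteSpace E]
    (hE : SigmaDedekindComplete E) (p : ℝ) (hp : 1 ≤ p) :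
    List.TFAE [
      DisjointDPStarP p E,
      ∀ x : ℕ → E, DisjointSeq x → WeaklyPSummable p x → IsAlmostLimitedSet (Set.range x),
      ∀ x : ℕ → E, DisjointSeq x → WeaklyPSummable p x →
        ∀ f : ℕ → StrongDual ℝ E, DisjointDualSeq f → WeakStarNull f →
          Tendsto (fun n => f n (x n)) atTop (𝓝 0),
      ∀ x : ℕ → E, DisjointSeq x → WeaklyPSummable p x →
        ∀ f : ℕ → StrongDual ℝ E, (∀ n, 0 ≤ f n) → DisjointDualSeq f → WeakStarNull f →
          Tendsto (fun n => f n (x n)) atTop (𝓝 0),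
      ∀ x : ℕ → E, DisjointSeq x → WeaklyPSummable p x →
        ∀ f : ℕ → StrongDual ℝ E, (∀ n, 0 ≤ f n) → WeakStarNull f →
          Tendsto (fun n => f n (x n)) atTop (𝓝 0)] := by
  simpa only [DisjointDPStarP, Subtype.forall, and_imp, List.map_cons, List.map_nil] using
    List.forall_tfae (α := {x : ℕ → E // DisjointSeq x ∧ WeaklyPSummable p x}) [_, _, _, _, _]
      fun x => theorem3p4_general hE x.2.1
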